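/- Let $\Bbbk=\mathbb{R}$ or $\mathbb{C}$, with $\langle x,y\rangle=x^*y$. For $d,n\in\mathbb{N}=\{1,2,\dots\}$ and a symmetric/Hermitian $n\times n$ matrix $A=(a_{ij})$ over $\Bbbk$, let $$\lVert A\rVert_{\gamma,d}^\Bbbk=\max\Bigl\{\Bigl|\sum_{i,j=1}^n a_{ij}\langle x_i,x_j\rangle\Bigr| : x_1,\dots,x_n\in\Bbbk^d,\ \lVert x_1\rVert=\dots=\lVert x_n\rVert=1\Bigr\},\qquad \lVert A\rVert_\gamma^\Bbbk=\lVert A\rVert_{\gamma,n}^\Bbbk .$$ Let $\mathbb{L}^n$ be the cone of weighted Laplacians, i.e. the real matrices $L_A=\operatorname{diag}(A\mathbb{1})-A$ with $A$ a real symmetric $n\times n$ matrix with zero diagonal and nonnegative entries. For $\mathsf{C}=\{\mathbb{L}^n:n\in\mathbb{N}\}$ put $$K_{\mathsf{C},d,p}^\Bbbk=\sup_{n\in\mathbb{N}}\ \sup_{0\ne L\in\mathbb{L}^n}\frac{\lVert L\rVert_{\gamma,p}^\Bbbk}{\lVert L\rVert_{\gamma,d}^\Bbbk}\quad(p\in\mathbb{N}),\qquad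 K_{\mathsf{C},d,\infty}^\Bbbk=\sup_{n\in\mathbb{N}}\ \sup_{0\ne L\in\mathbb{L}^n}\frac{\lVert L\rVert_{\gamma}^\Bbbk}{\lVert L\rVert_{\gamma,d}^\Bbbk},$$ and let the rank-$d$ Goemans–Williamson constant $K_{\mathsf{GW},d}^\Bbbk>0$ be the smallest positive constant $K$ such that $\lVert L\rVert_\gamma^\Bbbk\le K\,\lVert L\rVert_{\gamma,d}^\Bbbk$ for all $n\in\mathbb{N}$ and all $L\in\mathbb{L}^n$. For $z\in\Bbbk^d$ let $\operatorname{sgn} z=z/\lVert z\rVert$ if $z\ne0$ and $\operatorname{sgn}0=e_1$. Let $\varphi_d^\Bbbk$ be the function on the closed unit disc of $\Bbbk$ given by $$\varphi_d^\Bbbk(\langle u,v\rangle)=\int_{\Bbbk^{d\times n}}\bigl\langle\operatorname{sgn}(Zu),\operatorname{sgn}(Zv)\bigr\rangle\,G_{d,n}^\Bbbk(Z)\,dZ,\qquad u,v\in\Bbbk^n,\ \lVert u\rVert=\lVert v\rVert=1,\ n\ge2,$$ where $G_{d,n}^\mathbb{R}(Z)=(2\pi)^{-dn/2}e^{-\lVert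 Z\rVert^2/2}$ and $G_{d,n}^\mathbb{C}(Z)=\pi^{-dn}e^{-\lVert Z\rVert^2}$ with $\lVert\cdot\rVert$ the Frobenius norm; the integral depends only on $\langle u,v\rangle$, so that one may take $n=2$, $u=(1,0)$, $v=(x,\sqrt{1-|x|^2})$ to obtain $\varphi_d^\Bbbk(x)$. Put $$\alpha_d^\Bbbk=\inf_{0\le x\le1}\frac{1+\varphi_d^\Bbbk(x)}{1+x}.$$ Then for every $d\in\mathbb{N}$ and both $\Bbbk=\mathbb{R}$ and $\Bbbk=\mathbb{C}$, the smallest constant $K_{\mathsf{GW},d}^\Bbbk$ exists, and $$\lim_{p\to\infty}K_{\mathsf{C},d,p}^\Bbbk=K_{\mathsf{C},d,\infty}^\Bbbk=K_{\mathsf{GW},d}^\Bbbk\le\frac1{\alpha_d^\Bbbk}.$$ Moreover, $K_{\mathsf{GW},d}^\mathbb{C}=K_{\mathsf{GW},2d}^\mathbb{R}$. -/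

import Mathlib

open scoped ENNReal
open Filter Topology MeasureTheory

noncomputable section

namespace GW

/-! ### Grothendieck seminorms -/

/-- The `(γ,d)`-seminorm of an `n × n` matrix over `𝕜`: the maximum of `|∑ a_ij ⟨x_i, x_j⟩|` over all
unit vectors `x_1, …, x_n ∈ 𝕜^d` (Mathlib's inner product is conjugate-linear in the first slot). -/
def gammaRank (𝕜 : Type) [RCLike 𝕜] (d : ℕ) {n : ℕ} (A : Matrix (Fin n) (Fin n) 𝕜) : ℝ :=
  sSup {r : ℝ | ∃ x : Fin n → EuclideanSpace 𝕜 (Fin d), (∀ i, ‖x i‖ = 1) ∧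
    r = ‖∑ i, ∑ j, A i j * inner 𝕜 (x i) (x j)‖}

/-- The `γ`-seminorm of an `n × n` matrix: no constraint on the rank, so that vectors in `𝕜^n`
suffice. -/
def gammaNorm (𝕜 : Type) [RCLike 𝕜] {n : ℕ} (A : Matrix (Fin n) (Fin n) 𝕜) : ℝ :=
  gammaRank 𝕜 n A

/-! ### Conic Grothendieck constants -/

/-- `K_{C,d,p}`: the supremum over all `n` and all `A ∈ C n` of `‖A‖_{γ,p} / ‖A‖_{γ,d}`, in
`[0,∞]`, where `0 / 0 = 0` and `a / 0 = ∞` for `a > 0`. -/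
def conicConst (𝕜 : Type) [RCLike 𝕜] (C : (n : ℕ) → Set (Matrix (Fin n) (Fin n) 𝕜))
    (d p : ℕ) : ℝ≥0∞ :=
  ⨆ (n : ℕ), ⨆ A ∈ C n, ENNReal.ofReal (gammaRank 𝕜 p A) / ENNReal.ofReal (gammaRank 𝕜 d A)

/-- `K_{C,d,∞}`: the supremum over all `n` and all `A ∈ C n` of `‖A‖_γ / ‖A‖_{γ,d}`. -/
def conicConstTop (𝕜 : Type) [RCLike 𝕜] (C : (n : ℕ) → Set (Matrix (Fin n) (Fin n) 𝕜))
    (d : ℕ) : ℝ≥0∞ :=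
  ⨆ (n : ℕ), ⨆ A ∈ C n, ENNReal.ofReal (gammaNorm 𝕜 A) / ENNReal.ofReal (gammaRank 𝕜 d A)

/-! ### Weighted Laplacians and the rank-`d` Goemans–Williamson constant -/

/-- The cone of weighted Laplacians `L_A = diag(A𝟙) - A`, where `A` is a real symmetric matrix with
zero diagonal and nonnegative entries. -/
def laplacianCone (n : ℕ) : Set (Matrix (Fin n) (Fin n) ℝ) :=
  {L | ∃ A : Matrix (Fin n) (Fin n) ℝ, A.IsSymm ∧ (∀ i, A i i = 0) ∧ (∀ i j, 0 ≤ A i j) ∧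
    L = Matrix.diagonal (fun i => ∑ j, A i j) - A}

/-- A real matrix regarded as a matrix over `𝕜`. -/
def toField (𝕜 : Type) [RCLike 𝕜] {n : ℕ} (A : Matrix (Fin n) (Fin n) ℝ) :
    Matrix (Fin n) (Fin n) 𝕜 :=
  A.map (fun t : ℝ => (t : 𝕜))

/-- The family of cones of weighted Laplacians, regarded as matrices over `𝕜`. -/
def laplacianFamily (𝕜 : Type) [RCLike 𝕜] (n : ℕ) : Set (Matrix (Fin n) (Fin n) 𝕜) :=
  toField 𝕜 '' laplacianCone n

/-- The positive constants `K` such that `‖L‖_γ ≤ K ‖L‖_{γ,d}` for all `n` and all `n × n` weighted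
Laplacians `L`, with both seminorms taken over `𝕜`. -/
def gwBounds (𝕜 : Type) [RCLike 𝕜] (d : ℕ) : Set ℝ :=
  {K : ℝ | 0 < K ∧ ∀ (n : ℕ), ∀ L ∈ laplacianCone n,
    gammaNorm 𝕜 (toField 𝕜 L) ≤ K * gammaRank 𝕜 d (toField 𝕜 L)}

/-- The rank-`d` Goemans–Williamson constant: the sharpest constant in `gwBounds`. -/
def gwConst (𝕜 : Type) [RCLike 𝕜] (d : ℕ) : ℝ :=
  sInf (gwBounds 𝕜 d)

/-! ### The functions `φ_d` and the constants `α_d` -/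

/-- The sign of a vector: `z / ‖z‖` for `z ≠ 0`, and the first unit vector for `z = 0`. -/
def vecSign {𝕜 : Type} [RCLike 𝕜] {d : ℕ} (z : EuclideanSpace 𝕜 (Fin d)) :
    EuclideanSpace 𝕜 (Fin d) :=
  open Classical in
  if z = 0 then WithLp.toLp 2 (fun i => if (i : ℕ) = 0 then 1 else 0)
  else ((‖z‖⁻¹ : ℝ) : 𝕜) • z

/-- The product of the `d × n` matrix `Z` and the vector `u`. -/
def matVec {𝕜 : Type} [RCLike 𝕜] {d n : ℕ} (Z : Fin d → Fin n → 𝕜)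
    (u : EuclideanSpace 𝕜 (Fin n)) : EuclideanSpace 𝕜 (Fin d) :=
  WithLp.toLp 2 (fun i => ∑ j, Z i j * u j)

/-- The standard Gaussian density on real `d × n` matrices. -/
def gaussReal (d n : ℕ) (Z : Fin d → Fin n → ℝ) : ℝ :=
  (2 * Real.pi) ^ (-((d : ℝ) * n / 2)) * Real.exp (-(∑ i, ∑ j, ‖Z i j‖ ^ 2) / 2)

/-- The standard Gaussian density on complex `d × n` matrices. -/
def gaussComplex (d n : ℕ) (Z : Fin d → Fin n → ℂ) : ℝ :=
  Real.pi ^ (-((d : ℝ) * n)) * Real.exp (-(∑ i, ∑ j, ‖Z i j‖ ^ 2))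

/-- The integral `∫ ⟨sign (Z u), sign (Z v)⟩ G(Z) dZ` over all real `d × n` matrices. -/
def signIntegralReal (d : ℕ) {n : ℕ} (u v : EuclideanSpace ℝ (Fin n)) : ℝ :=
  ∫ Z : Fin d → Fin n → ℝ,
    inner ℝ (vecSign (matVec Z u)) (vecSign (matVec Z v)) * gaussReal d n Z

/-- The integral `∫ ⟨sign (Z u), sign (Z v)⟩ G(Z) dZ` over all complex `d × n` matrices. -/
def signIntegralComplex (d : ℕ) {n : ℕ} (u v : EuclideanSpace ℂ (Fin n)) : ℂ :=
  ∫ Z : Fin d → Fin n → ℂ,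
    inner ℂ (vecSign (matVec Z u)) (vecSign (matVec Z v)) * ((gaussComplex d n Z : ℝ) : ℂ)

/-- `φ_d` over `ℝ`, for `|x| ≤ 1`. The sign integral of unit vectors `u, v ∈ ℝ^n` depends on
`⟨u, v⟩` only, and `φ_d(⟨u, v⟩)` is its value; here it is taken at
`u = (1, 0)`, `v = (x, √(1 - x²))`. -/
def phiReal (d : ℕ) (x : ℝ) : ℝ :=
  signIntegralReal d !₂[(1 : ℝ), 0] !₂[x, √(1 - x ^ 2)]

/-- `φ_d` over `ℂ`, for `|x| ≤ 1`, taken at `u = (1, 0)`, `v = (x, √(1 - |x|²))`. -/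
def phiComplex (d : ℕ) (x : ℂ) : ℂ :=
  signIntegralComplex d !₂[(1 : ℂ), 0] !₂[x, ((√(1 - ‖x‖ ^ 2) : ℝ) : ℂ)]

/-- `α_d` over `ℝ`. -/
def alphaReal (d : ℕ) : ℝ :=
  ⨅ x : Set.Icc (0 : ℝ) 1, (1 + phiReal d (x : ℝ)) / (1 + (x : ℝ))

/-- `α_d` over `ℂ` (the values of `φ_d` over `ℂ` at real arguments are real, so that taking the real
part does not change them). -/
def alphaComplex (d : ℕ) : ℝ :=
  ⨅ x : Set.Icc (0 : ℝ) 1, (1 + (phiComplex d ((x : ℝ) : ℂ)).re) / (1 + (x : ℝ))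

end GW

end

/-!
The seminorms depend only on the Gram matrix of the unit vectors, so the vectors may be taken in any
inner product space. As a Gram matrix of `n` vectors is realized in `𝕜^n`, the seminorm with rank
`p` increases to its maximum `gammaNorm`, which gives the limit. For real symmetric matrices `ℂ^d`
may be replaced by its underlying real space `ℝ^{2d}`, which gives the relation between the fields.

For the bound, the unit vectors `x_i` are rounded to `sgn (Z x_i)` with `Z` a Gaussian matrix, whose
expected Gram matrix is `φ ⟪x_i, x_j⟫`. The form of a Laplacian is `∑ a_ij (1 - ⟪x_i, x_j⟫)` with
`a_ij ≥ 0`, so it suffices that `α (1 - t) ≤ 1 - φ(t)` on `[-1, 1]`. For `t < 0` this is the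
definition of `α`, since `φ` is odd; for `t ≥ 0` it follows from `φ(t) ≤ t`.

The last inequality holds because `φ` is positive definite on spheres of every dimension. Testing
this on one vector at a common angle to `N` others gives `φ(t)² ≤ φ(t²)` as `N → ∞` and
`N φ(s)² ≤ 1` whenever `N s² ≤ 1`, hence `φ(s)² ≤ 2 s²`. With `s = t^{2^k}` this yields
`(φ(t) / t)^{2^{k+1}} ≤ 2` for all `k`, so `φ(t) ≤ t`.
-/

namespace GW

section GammaOn

variable (𝕜 : Type) [RCLike 𝕜] (E : Type*) [NormedAddCommGroup E] [InnerProductSpace 𝕜 E] {n : ℕ}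

/-- The `γ`-seminorm of a matrix with the unit vectors taken from an arbitrary inner product space
`E`; `gammaRank 𝕜 d` is the case `E = 𝕜^d`. -/
noncomputable def gammaOn (A : Matrix (Fin n) (Fin n) 𝕜) : ℝ :=
  sSup {r : ℝ | ∃ x : Fin n → E, (∀ i, ‖x i‖ = 1) ∧ r = ‖∑ i, ∑ j, A i j * inner 𝕜 (x i) (x j)‖}

variable {𝕜 E}

lemma norm_sum_mul_inner_le_gammaOn (A : Matrix (Fin n) (Fin n) 𝕜) {x : Fin n → E}
    (hx : ∀ i, ‖x i‖ = 1) : ‖∑ i, ∑ j, A i j * inner 𝕜 (x i) (x j)‖ ≤ gammaOn 𝕜 E A := by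
  refine le_csSup ⟨∑ i, ∑ j, ‖A i j‖, ?_⟩ ⟨x, hx, rfl⟩
  rintro _ ⟨y, hy, rfl⟩
  refine norm_sum_le_of_le _ fun i _ => norm_sum_le_of_le _ fun j _ => ?_
  rw [norm_mul]
  refine mul_le_of_le_one_right (norm_nonneg _) ((norm_inner_le_norm _ _).trans ?_)
  rw [hy, hy, one_mul]

lemma gammaOn_le {A : Matrix (Fin n) (Fin n) 𝕜} {K : ℝ} (hK : 0 ≤ K)
    (h : ∀ x : Fin n → E, (∀ i, ‖x i‖ = 1) → ‖∑ i, ∑ j, A i j * inner 𝕜 (x i) (x j)‖ ≤ K) :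
    gammaOn 𝕜 E A ≤ K :=
  Real.sSup_le (by rintro _ ⟨x, hx, rfl⟩; exact h x hx) hK

lemma gammaOn_nonneg (A : Matrix (Fin n) (Fin n) 𝕜) : 0 ≤ gammaOn 𝕜 E A :=
  Real.sSup_nonneg (by rintro _ ⟨x, -, rfl⟩; exact norm_nonneg _)

variable {F : Type*} [NormedAddCommGroup F] [InnerProductSpace 𝕜 F]

lemma gammaOn_le_gammaOn_of_forall_exists (A : Matrix (Fin n) (Fin n) 𝕜)
    (h : ∀ x : Fin n → E, ∃ y : Fin n → F, ∀ i j, inner 𝕜 (y i) (y j) = inner 𝕜 (x i) (x j)) :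
    gammaOn 𝕜 E A ≤ gammaOn 𝕜 F A := by
  refine gammaOn_le (gammaOn_nonneg A) fun x hx => ?_
  obtain ⟨y, hy⟩ := h x
  have hy_norm : ∀ i, ‖y i‖ = 1 := fun i => by
    rw [@norm_eq_sqrt_re_inner 𝕜, hy, ← norm_eq_sqrt_re_inner, hx]
  simpa only [hy] using norm_sum_mul_inner_le_gammaOn A hy_norm

lemma gammaOn_le_of_linearIsometry (f : E →ₗᵢ[𝕜] F) (A : Matrix (Fin n) (Fin n) 𝕜) :
    gammaOn 𝕜 E A ≤ gammaOn 𝕜 F A :=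
  gammaOn_le_gammaOn_of_forall_exists A fun x => ⟨f ∘ x, fun _ _ => f.inner_map_map _ _⟩

lemma gammaOn_congr (e : E ≃ₗᵢ[𝕜] F) (A : Matrix (Fin n) (Fin n) 𝕜) :
    gammaOn 𝕜 E A = gammaOn 𝕜 F A :=
  (gammaOn_le_of_linearIsometry e.toLinearIsometry A).antisymm
    (gammaOn_le_of_linearIsometry e.symm.toLinearIsometry A)

lemma exists_inner_eq_inner (x : Fin n → E) : ∃ y : Fin n → EuclideanSpace 𝕜 (Fin n),
    ∀ i j, inner 𝕜 (y i) (y j) = inner 𝕜 (x i) (x j) := by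
  open scoped ComplexOrder MatrixOrder Matrix.Norms.L2Operator in
  obtain ⟨B, hB⟩ := CStarAlgebra.nonneg_iff_eq_star_mul_self.mp
    (Matrix.posSemidef_gram 𝕜 x).nonneg
  refine ⟨fun i => WithLp.toLp 2 fun k => B k i, fun i j => ?_⟩
  rw [← Matrix.gram_apply (𝕜 := 𝕜) (v := x), hB, Matrix.star_eq_conjTranspose, Matrix.mul_apply]
  simp [PiLp.inner_apply, mul_comm]

lemma gammaOn_le_gammaNorm (A : Matrix (Fin n) (Fin n) 𝕜) : gammaOn 𝕜 E A ≤ gammaNorm 𝕜 A :=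
  gammaOn_le_gammaOn_of_forall_exists A exists_inner_eq_inner

lemma monotone_gammaRank (A : Matrix (Fin n) (Fin n) 𝕜) : Monotone fun p => gammaRank 𝕜 p A := by
  intro p q hpq
  let e := EuclideanSpace.basisFun (Fin q) 𝕜 ∘ Fin.castLE hpq
  have he : Orthonormal 𝕜 e := (EuclideanSpace.basisFun (Fin q) 𝕜).orthonormal.comp _
    (Fin.castLE_injective hpq)
  let b := EuclideanSpace.basisFun (Fin p) 𝕜
  have hb : Orthonormal 𝕜 b.toBasis := by simp [b.orthonormal]
  exact gammaOn_le_of_linearIsometry ((b.toBasis.constr 𝕜 e).isometryOfOrthonormal hb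
    (by convert he; ext1 i; exact b.toBasis.constr_basis 𝕜 e i)) A

end GammaOn

lemma tendsto_conicConst (𝕜 : Type) [RCLike 𝕜] (C : (n : ℕ) → Set (Matrix (Fin n) (Fin n) 𝕜))
    (d : ℕ) : Tendsto (conicConst 𝕜 C d) atTop (𝓝 (conicConstTop 𝕜 C d)) := by
  have hmono : Monotone (conicConst 𝕜 C d) := fun p q hpq =>
    iSup_mono fun n => iSup₂_mono fun A _ => by gcongr; exact monotone_gammaRank A hpq
  convert tendsto_atTop_iSup hmono using 2
  refine le_antisymm (iSup_le fun n => ?_) (iSup_le fun p => iSup_mono fun n => ?_)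
  · exact le_iSup_of_le n (le_iSup_of_le n le_rfl)
  · exact iSup₂_mono fun A _ => by gcongr; exact gammaOn_le_gammaNorm A

section GoemansWilliamson

variable {𝕜 : Type} [RCLike 𝕜] {d : ℕ}

lemma mem_gwBounds_iff_conicConstTop_le {K : ℝ} (hK : 0 < K) :
    K ∈ gwBounds 𝕜 d ↔ conicConstTop 𝕜 (laplacianFamily 𝕜) d ≤ ENNReal.ofReal K := by
  simp only [gwBounds, Set.mem_ofPred_eq, hK, true_and, conicConstTop, laplacianFamily, iSup_le_iff,
    Set.forall_mem_image]
  refine forall_congr' fun n => forall₂_congr fun L _ => ?_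
  rw [ENNReal.div_le_iff_le_mul (.inr ENNReal.ofReal_ne_top) (.inl ENNReal.ofReal_ne_top),
    ← ENNReal.ofReal_mul hK.le]
  exact (ENNReal.ofReal_le_ofReal_iff (mul_nonneg hK.le (gammaOn_nonneg _))).symm

lemma exists_mem_laplacianCone_gammaNorm_pos :
    ∃ L ∈ laplacianCone 2, 0 < gammaNorm 𝕜 (toField 𝕜 L) := by
  refine ⟨!![1, -1; -1, 1], ⟨!![0, 1; 1, 0], ?_, ?_, ?_, ?_⟩, ?_⟩
  · ext i j; fin_cases i <;> fin_cases j <;> rfl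
  · simp [Fin.forall_fin_two]
  · simp [Fin.forall_fin_two]
  · ext i j; fin_cases i <;> fin_cases j <;> simp
  · let e : EuclideanSpace 𝕜 (Fin 2) := EuclideanSpace.single 0 1
    have he : ∀ i, ‖![e, -e] i‖ = 1 := by simp [Fin.forall_fin_two, e]
    refine lt_of_lt_of_le ?_ (norm_sum_mul_inner_le_gammaOn _ he)
    simp [toField, Fin.sum_univ_two, e]

lemma conicConstTop_laplacianFamily_ne_zero : conicConstTop 𝕜 (laplacianFamily 𝕜) d ≠ 0 := by
  obtain ⟨L, hL, hpos⟩ := exists_mem_laplacianCone_gammaNorm_pos (𝕜 := 𝕜)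
  have hratio : ENNReal.ofReal (gammaNorm 𝕜 (toField 𝕜 L)) /
      ENNReal.ofReal (gammaRank 𝕜 d (toField 𝕜 L)) ≤ conicConstTop 𝕜 (laplacianFamily 𝕜) d :=
    le_iSup_of_le 2 (le_iSup₂_of_le _ ⟨L, hL, rfl⟩ le_rfl)
  refine ((ENNReal.div_pos ?_ ENNReal.ofReal_ne_top).trans_le hratio).ne'
  exact (ENNReal.ofReal_pos.2 hpos).ne'

lemma isLeast_gwBounds_toReal_conicConstTop (hne : (gwBounds 𝕜 d).Nonempty) :
    IsLeast (gwBounds 𝕜 d) (conicConstTop 𝕜 (laplacianFamily 𝕜) d).toReal := by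
  obtain ⟨K, hK⟩ := hne
  have hfin : conicConstTop 𝕜 (laplacianFamily 𝕜) d ≠ ∞ :=
    ne_top_of_le_ne_top ENNReal.ofReal_ne_top ((mem_gwBounds_iff_conicConstTop_le hK.1).1 hK)
  refine ⟨?_, fun K' hK' => ?_⟩
  · rw [mem_gwBounds_iff_conicConstTop_le
      (ENNReal.toReal_pos conicConstTop_laplacianFamily_ne_zero hfin), ENNReal.ofReal_toReal hfin]
  · exact ENNReal.toReal_le_of_le_ofReal hK'.1.le ((mem_gwBounds_iff_conicConstTop_le hK'.1).1 hK')

lemma isLeast_gwConst (hne : (gwBounds 𝕜 d).Nonempty) :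
    IsLeast (gwBounds 𝕜 d) (gwConst 𝕜 d) := by
  have h := isLeast_gwBounds_toReal_conicConstTop hne
  rwa [gwConst, h.csInf_eq]

lemma conicConstTop_eq_ofReal_gwConst (hne : (gwBounds 𝕜 d).Nonempty) :
    conicConstTop 𝕜 (laplacianFamily 𝕜) d = ENNReal.ofReal (gwConst 𝕜 d) := by
  have h := isLeast_gwBounds_toReal_conicConstTop hne
  have hpos := h.1.1
  rw [gwConst, h.csInf_eq, ENNReal.ofReal_toReal]
  exact (ENNReal.toReal_pos_iff.1 hpos).2.ne

end GoemansWilliamson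

section RealVersusComplex

variable {d n : ℕ}

lemma toField_real (A : Matrix (Fin n) (Fin n) ℝ) : toField ℝ A = A := by
  ext i j; rfl

lemma real_inner_eq_re_inner_euclideanSpace {ι : Type*} [Fintype ι] (x y : EuclideanSpace ℂ ι) :
    inner ℝ x y = (inner ℂ x y).re := by
  simp [PiLp.inner_apply, Complex.inner]

lemma gammaRank_complex_eq_gammaOn {A : Matrix (Fin n) (Fin n) ℝ} (hA : A.IsSymm) :
    gammaRank ℂ d (toField ℂ A) = gammaOn ℝ (EuclideanSpace ℂ (Fin d)) A := by
  have hreal : ∀ x : Fin n → EuclideanSpace ℂ (Fin d),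
      ∑ i, ∑ j, toField ℂ A i j * inner ℂ (x i) (x j) =
        ((∑ i, ∑ j, A i j * inner ℝ (x i) (x j) : ℝ) : ℂ) := fun x => by
    have hconj : starRingEnd ℂ (∑ i, ∑ j, toField ℂ A i j * inner ℂ (x i) (x j)) =
        ∑ i, ∑ j, toField ℂ A i j * inner ℂ (x i) (x j) := by
      simp only [map_sum, map_mul, inner_conj_symm, toField, Matrix.map_apply, RCLike.conj_ofReal]
      rw [Finset.sum_comm]
      simp only [hA.apply]
    rw [← Complex.conj_eq_iff_re.1 hconj]
    simp [toField, real_inner_eq_re_inner_euclideanSpace]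
  simp only [gammaRank, gammaOn, hreal, Complex.norm_real]

lemma gammaRank_complex_eq {A : Matrix (Fin n) (Fin n) ℝ} (hA : A.IsSymm) :
    gammaRank ℂ d (toField ℂ A) = gammaRank ℝ (2 * d) A := by
  have hdim : Module.finrank ℝ (EuclideanSpace ℂ (Fin d)) = 2 * d := by
    rw [finrank_real_of_complex, finrank_euclideanSpace_fin]
  exact (gammaRank_complex_eq_gammaOn hA).trans
    (gammaOn_congr ((stdOrthonormalBasis ℝ _).reindex (finCongr hdim)).repr A)

lemma gammaNorm_complex_eq {A : Matrix (Fin n) (Fin n) ℝ} (hA : A.IsSymm) :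
    gammaNorm ℂ (toField ℂ A) = gammaNorm ℝ A :=
  (gammaRank_complex_eq hA).trans
    ((gammaOn_le_gammaNorm A).antisymm (monotone_gammaRank A (Nat.le_mul_of_pos_left n two_pos)))

lemma isSymm_of_mem_laplacianCone {L : Matrix (Fin n) (Fin n) ℝ} (hL : L ∈ laplacianCone n) :
    L.IsSymm := by
  obtain ⟨A, hA, -, -, rfl⟩ := hL
  exact (Matrix.isSymm_diagonal _).sub hA

lemma gwBounds_complex_eq (d : ℕ) : gwBounds ℂ d = gwBounds ℝ (2 * d) := by
  refine Set.ext fun K => and_congr_right fun _ => forall_congr' fun n =>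
    forall₂_congr fun L hL => ?_
  have hsymm := isSymm_of_mem_laplacianCone hL
  rw [gammaNorm_complex_eq hsymm, gammaRank_complex_eq hsymm, toField_real]

end RealVersusComplex

/-- Schoenberg's positive definite functions on spheres of every dimension: entrywise application
of `φ` keeps Gram matrices of unit vectors positive semidefinite. -/
def IsSpherePosDef (φ : ℝ → ℝ) : Prop :=
  ∀ (s ι : Type) [Finite s] [Fintype ι] (u : s → EuclideanSpace ℝ ι), (∀ a, ‖u a‖ = 1) →
    ((Matrix.gram ℝ u).map φ).PosSemidef

namespace IsSpherePosDef

variable {φ : ℝ → ℝ}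

lemma natCast_mul_sq_le (h : IsSpherePosDef φ) (h1 : φ 1 = 1) {N : ℕ} (hN : 0 < N) {t p : ℝ}
    {ι : Type} [Fintype ι] {w : EuclideanSpace ℝ ι} {v : Fin N → EuclideanSpace ℝ ι}
    (hw : ‖w‖ = 1) (hwv : ∀ i, inner ℝ w (v i) = t)
    (hvv : ∀ i j, inner ℝ (v i) (v j) = if i = j then 1 else p) :
    N * φ t ^ 2 ≤ 1 + (N - 1) * φ p := by
  have hv : ∀ i, ‖v i‖ = 1 := fun i => by
    rw [norm_eq_sqrt_real_inner, hvv, if_pos rfl, Real.sqrt_one]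
  have hvw : ∀ i, inner ℝ (v i) w = t := fun i => by rw [real_inner_comm, hwv]
  have hφvv : ∀ i j, φ (inner ℝ (v i) (v j)) = φ p + if i = j then 1 - φ p else 0 := by
    intro i j
    rw [hvv]
    split_ifs <;> simp [h1]
  let u : Option (Fin N) → EuclideanSpace ℝ ι := fun a => a.elim w v
  -- The weight of `w` minimizes the quadratic form when each `v i` has weight `1`.
  let c : Option (Fin N) → ℝ := fun a => a.elim (-(N * φ t)) fun _ => 1
  have hquad : 0 ≤ N * (1 + (N - 1) * φ p - N * φ t ^ 2) := by
    refine ((h _ _ u (Option.rec hw hv)).dotProduct_mulVec_nonneg c).trans_eq ?_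
    simp only [u, c, dotProduct, Matrix.mulVec, Matrix.map_apply, Matrix.gram_apply,
      Fintype.sum_option, Option.elim_none, Option.elim_some, Pi.star_apply, star_trivial,
      real_inner_self_eq_norm_sq, hw, one_pow, h1, hwv, hvw, hφvv, mul_one, one_mul,
      Finset.sum_add_distrib, Finset.sum_ite_eq, Finset.mem_univ, if_true, Finset.sum_const,
      Finset.card_univ, Fintype.card_fin, nsmul_eq_mul]
    ring
  linarith [nonneg_of_mul_nonneg_right hquad (Nat.cast_pos.2 hN)]

lemma sq_apply_le_apply_sq (h : IsSpherePosDef φ) (h1 : φ 1 = 1) {t : ℝ} (ht : |t| ≤ 1) :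
    φ t ^ 2 ≤ φ (t ^ 2) := by
  have hs : √(1 - t ^ 2) * √(1 - t ^ 2) = 1 - t ^ 2 :=
    Real.mul_self_sqrt (sub_nonneg.2 ((sq_le_one_iff_abs_le_one t).2 ht))
  have hbound : ∀ N : ℕ, (N + 1) * (φ t ^ 2 - φ (t ^ 2)) ≤ 1 - φ (t ^ 2) := fun N => by
    have := h.natCast_mul_sq_le h1 N.succ_pos (t := t) (p := t ^ 2)
      (w := EuclideanSpace.single none 1)
      (v := fun i => t • EuclideanSpace.single none 1 +
        √(1 - t ^ 2) • EuclideanSpace.single (some i) 1)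
      (by simp) (by simp [EuclideanSpace.inner_single_left]) fun i j => by
        simp only [EuclideanSpace.inner_eq_star_dotProduct, dotProduct, Fintype.sum_option]
        by_cases hij : i = j <;> simp [hij, hs] <;> ring
    push_cast at this
    linarith
  by_contra! hlt
  obtain ⟨N, hN⟩ := exists_lt_nsmul (sub_pos.2 hlt) (1 - φ (t ^ 2))
  rw [nsmul_eq_mul] at hN
  linarith [hbound N]

lemma apply_nonneg (h : IsSpherePosDef φ) (h1 : φ 1 = 1) {t : ℝ} (h0t : 0 ≤ t) (ht : t ≤ 1) :
    0 ≤ φ t := by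
  have := h.sq_apply_le_apply_sq h1 (t := √t) (by simpa [abs_of_nonneg] using ht)
  rw [Real.sq_sqrt h0t] at this
  exact (sq_nonneg _).trans this

lemma pow_apply_le_apply_pow (h : IsSpherePosDef φ) (h1 : φ 1 = 1) {t : ℝ} (h0t : 0 ≤ t)
    (ht : t ≤ 1) (k : ℕ) : φ t ^ 2 ^ k ≤ φ (t ^ 2 ^ k) := by
  induction k with
  | zero => simp
  | succ k ih =>
    have hφt := h.apply_nonneg h1 h0t ht
    calc φ t ^ 2 ^ (k + 1) = (φ t ^ 2 ^ k) ^ 2 := by rw [pow_succ, pow_mul]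
      _ ≤ φ (t ^ 2 ^ k) ^ 2 := by gcongr
      _ ≤ φ ((t ^ 2 ^ k) ^ 2) := h.sq_apply_le_apply_sq h1 <| by
        rw [abs_of_nonneg (by positivity)]
        exact pow_le_one₀ h0t ht
      _ = φ (t ^ 2 ^ (k + 1)) := by rw [← pow_mul, ← pow_succ]

lemma natCast_mul_sq_le_one (h : IsSpherePosDef φ) (h0 : φ 0 = 0) (h1 : φ 1 = 1) {N : ℕ} {t : ℝ}
    (ht : N * t ^ 2 ≤ 1) : N * φ t ^ 2 ≤ 1 := by
  rcases N.eq_zero_or_pos with rfl | hN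
  · simp
  have := h.natCast_mul_sq_le h1 hN (t := t) (p := 0)
    (w := WithLp.toLp 2 fun k => k.elim √(1 - N * t ^ 2) fun _ => t)
    (v := fun i => EuclideanSpace.single (some i) 1)
    (by simp [EuclideanSpace.norm_eq, Fintype.sum_option, ht])
    (by simp [EuclideanSpace.inner_single_right])
    (by simp [EuclideanSpace.inner_single_right, eq_comm])
  simpa [h0] using this

lemma sq_apply_le_two_mul_sq (h : IsSpherePosDef φ) (h0 : φ 0 = 0) (h1 : φ 1 = 1) {t : ℝ}
    (h0t : 0 < t) (ht : t ≤ 1) : φ t ^ 2 ≤ 2 * t ^ 2 := by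
  set N := ⌊1 / t ^ 2⌋₊
  have hN : (1 : ℝ) ≤ N := by
    exact_mod_cast Nat.floor_pos.2 (one_le_one_div (by positivity) (pow_le_one₀ h0t.le ht))
  have hN_le : N * t ^ 2 ≤ 1 := by
    rw [← le_div_iff₀ (by positivity)]
    exact Nat.floor_le (by positivity)
  have hN_lt : 1 < (N + 1) * t ^ 2 := by
    rw [← div_lt_iff₀ (by positivity)]
    exact Nat.lt_floor_add_one _
  have hφ := h.natCast_mul_sq_le_one h0 h1 hN_le
  have : N * φ t ^ 2 ≤ N * (2 * t ^ 2) := by nlinarith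
  exact le_of_mul_le_mul_left this (by linarith)

lemma apply_le_self (h : IsSpherePosDef φ) (h0 : φ 0 = 0) (h1 : φ 1 = 1) {t : ℝ}
    (h0t : 0 ≤ t) (ht : t ≤ 1) : φ t ≤ t := by
  rcases h0t.eq_or_lt with rfl | hpos
  · rw [h0]
  have hφt := h.apply_nonneg h1 h0t ht
  by_contra! hlt
  have hratio : 1 < φ t / t := (one_lt_div hpos).2 hlt
  obtain ⟨k, hk⟩ := pow_unbounded_of_one_lt 2 hratio
  have hsq : (φ t ^ 2 ^ k) ^ 2 ≤ 2 * (t ^ 2 ^ k) ^ 2 :=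
    calc (φ t ^ 2 ^ k) ^ 2 ≤ φ (t ^ 2 ^ k) ^ 2 := by
          gcongr
          exact h.pow_apply_le_apply_pow h1 h0t ht k
      _ ≤ 2 * (t ^ 2 ^ k) ^ 2 :=
          h.sq_apply_le_two_mul_sq h0 h1 (by positivity) (pow_le_one₀ h0t ht)
  have hbounded : (φ t / t) ^ (2 ^ k * 2) ≤ 2 := by
    rwa [div_pow, div_le_iff₀ (by positivity), pow_mul, pow_mul]
  have hexp : k ≤ 2 ^ k * 2 := k.lt_two_pow_self.le.trans (Nat.le_mul_of_pos_right _ two_pos)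
  linarith [pow_le_pow_right₀ hratio.le hexp]

end IsSpherePosDef

section GaussianMatrix

open Complex (I)

variable {m ι H : Type*} [Fintype m] [Fintype ι] [NormedAddCommGroup H] [InnerProductSpace ℝ H]
  {b : ℝ}

/-- The centred isotropic Gaussian density on `H` proportional to `exp (-b ‖z‖²)`. The standard
Gaussian is `b = 1 / 2` over `ℝ` and `b = 1` over `ℂ`. -/
noncomputable def gaussPDF (b : ℝ) (z : H) : ℝ :=
  (Real.pi / b) ^ (-(Module.finrank ℝ H / 2 : ℝ)) * Real.exp (-b * ‖z‖ ^ 2)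

lemma gaussPDF_nonneg (hb : 0 < b) (z : H) : 0 ≤ gaussPDF b z := by
  unfold gaussPDF; positivity

variable [MeasurableSpace H] [BorelSpace H]

lemma measurable_gaussPDF : Measurable (gaussPDF b : H → ℝ) := by
  unfold gaussPDF; fun_prop

variable [FiniteDimensional ℝ H]

lemma integral_gaussPDF_mul_cexp (hb : 0 < b) (w : H) :
    ∫ z, (gaussPDF b z : ℂ) * Complex.exp (inner ℝ w z * I) =
      Complex.exp (-‖w‖ ^ 2 / (4 * b)) := by
  have hpi : (Real.pi / b : ℂ) ^ (Module.finrank ℝ H / 2 : ℂ) ≠ 0 := by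
    simp [Complex.cpow_eq_zero_iff, hb.ne', Real.pi_ne_zero]
  calc ∫ z, (gaussPDF b z : ℂ) * Complex.exp (inner ℝ w z * I)
      = (Real.pi / b : ℂ) ^ (-(Module.finrank ℝ H / 2 : ℂ)) *
          ∫ z, Complex.exp (-b * ‖z‖ ^ 2 + I * inner ℝ w z) := by
        rw [← integral_const_mul]
        congr with z
        rw [gaussPDF, Complex.ofReal_mul, Complex.ofReal_cpow (by positivity), Complex.ofReal_exp,
          mul_assoc, ← Complex.exp_add, mul_comm I]
        push_cast
        rfl
    _ = Complex.exp (I ^ 2 * ‖w‖ ^ 2 / (4 * b)) := by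
        rw [GaussianFourier.integral_cexp_neg_mul_sq_norm_add (by simpa) I w, Complex.cpow_neg,
          inv_mul_cancel_left₀ hpi]
    _ = Complex.exp (-‖w‖ ^ 2 / (4 * b)) := by rw [Complex.I_sq, neg_one_mul]

/-- The law of an `m × ι` matrix of independent entries with density `gaussPDF b`. -/
noncomputable def gaussMeasure (m ι H : Type*) [Fintype m] [Fintype ι] [NormedAddCommGroup H]
    [InnerProductSpace ℝ H] [FiniteDimensional ℝ H] [MeasurableSpace H] [BorelSpace H] (b : ℝ) :
    Measure (m → ι → H) :=
  volume.withDensity fun Z => ENNReal.ofReal (∏ i, ∏ j, gaussPDF b (Z i j))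

lemma integral_gaussMeasure {G : Type*} [NormedAddCommGroup G] [NormedSpace ℝ G] (hb : 0 < b)
    (f : (m → ι → H) → G) :
    ∫ Z, f Z ∂gaussMeasure m ι H b = ∫ Z, (∏ i, ∏ j, gaussPDF b (Z i j)) • f Z := by
  have hmeas : Measurable fun Z : m → ι → H => ∏ i, ∏ j, gaussPDF b (Z i j) :=
    Finset.measurable_fun_prod _ fun i _ => Finset.measurable_fun_prod _ fun j _ =>
      measurable_gaussPDF.comp (by fun_prop)
  rw [gaussMeasure, integral_withDensity_eq_integral_toReal_smul hmeas.ennreal_ofReal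
    (.of_forall fun _ => ENNReal.ofReal_lt_top)]
  congr with Z
  rw [ENNReal.toReal_ofReal (Finset.prod_nonneg fun _ _ => Finset.prod_nonneg fun _ _ =>
    gaussPDF_nonneg hb _)]

lemma integral_cexp_gaussMeasure (hb : 0 < b) (W : m → ι → H) :
    ∫ Z, Complex.exp ((∑ i, ∑ j, inner ℝ (W i j) (Z i j) : ℝ) * I) ∂gaussMeasure m ι H b =
      Complex.exp (-(∑ i, ∑ j, ‖W i j‖ ^ 2 : ℝ) / (4 * b)) := by
  calc ∫ Z, Complex.exp ((∑ i, ∑ j, inner ℝ (W i j) (Z i j) : ℝ) * I) ∂gaussMeasure m ι H b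
      = ∫ Z : m → ι → H, ∏ i, ∏ j,
          (gaussPDF b (Z i j) : ℂ) * Complex.exp (inner ℝ (W i j) (Z i j) * I) := by
        rw [integral_gaussMeasure hb]
        congr with Z
        simp only [Finset.prod_mul_distrib, ← Complex.exp_sum, ← Finset.sum_mul, Complex.real_smul,
          Complex.ofReal_prod, Complex.ofReal_sum]
    _ = ∏ i, ∏ j, ∫ z : H, (gaussPDF b z : ℂ) * Complex.exp (inner ℝ (W i j) z * I) := by
        rw [integral_fintype_prod_volume_eq_prod fun i (Zi : ι → H) =>
          ∏ j, (gaussPDF b (Zi j) : ℂ) * Complex.exp (inner ℝ (W i j) (Zi j) * I)]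
        exact Finset.prod_congr rfl fun i _ => integral_fintype_prod_volume_eq_prod fun j z =>
          (gaussPDF b z : ℂ) * Complex.exp (inner ℝ (W i j) z * I)
    _ = Complex.exp (-(∑ i, ∑ j, ‖W i j‖ ^ 2 : ℝ) / (4 * b)) := by
        simp only [integral_gaussPDF_mul_cexp hb, ← Complex.exp_sum, ← Finset.sum_div,
          Finset.sum_neg_distrib, Complex.ofReal_sum, Complex.ofReal_pow]

lemma isProbabilityMeasure_gaussMeasure (hb : 0 < b) :
    IsProbabilityMeasure (gaussMeasure m ι H b) := by
  rw [isProbabilityMeasure_iff_real]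
  have := integral_cexp_gaussMeasure hb (0 : m → ι → H)
  simpa using this

lemma ae_gaussMeasure_of_ae_volume {p : (m → ι → H) → Prop} (h : ∀ᵐ Z, p Z) :
    ∀ᵐ Z ∂gaussMeasure m ι H b, p Z :=
  (withDensity_absolutelyContinuous _ _).ae_le h

end GaussianMatrix

section SignCorrelation

open NormedSpace (normalize)

variable {m ι κ H : Type*} [Fintype ι] [Fintype κ] [NormedAddCommGroup H]
  [InnerProductSpace ℝ H] {b : ℝ}

/-- The product `Z u` of a matrix `Z` with entries in `H` and a real vector `u`. -/
noncomputable def smulVec (u : EuclideanSpace ℝ ι) :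
    (m → ι → H) →L[ℝ] PiLp 2 fun _ : m => H where
  toFun Z := WithLp.toLp 2 fun i => ∑ j, u j • Z i j
  map_add' Z Z' := by ext; simp [Finset.sum_add_distrib]
  map_smul' c Z := by ext; simp [Finset.smul_sum, smul_comm c]
  cont := by fun_prop

lemma smulVec_apply (u : EuclideanSpace ℝ ι) (Z : m → ι → H) (i : m) :
    smulVec u Z i = ∑ j, u j • Z i j := rfl

lemma smulVec_neg (u : EuclideanSpace ℝ ι) (Z : m → ι → H) : smulVec (-u) Z = -smulVec u Z := by
  ext i; simp [smulVec_apply]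

lemma smulVec_ne_zero [Nonempty m] [Nontrivial H] {u : EuclideanSpace ℝ ι} (hu : u ≠ 0) :
    (smulVec u : (m → ι → H) →L[ℝ] _) ≠ 0 := by
  obtain ⟨j, hj⟩ : ∃ j, u j ≠ 0 := by
    by_contra! h
    exact hu (by ext j; exact h j)
  obtain ⟨z, hz⟩ := exists_ne (0 : H)
  obtain ⟨i⟩ := ‹Nonempty m›
  classical
  intro h
  have h0 : smulVec u (fun _ : m => Pi.single j z) i = 0 := by rw [h]; rfl
  simp [smulVec_apply, Pi.single_apply, hj, hz] at h0

variable [Fintype m]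

lemma sum_norm_sq_smul_add_smul (u v : EuclideanSpace ℝ ι) (x y : PiLp 2 fun _ : m => H) :
    ∑ i, ∑ j, ‖u j • x i + v j • y i‖ ^ 2 =
      ‖x‖ ^ 2 * ‖u‖ ^ 2 + 2 * (inner ℝ x y * inner ℝ u v) + ‖y‖ ^ 2 * ‖v‖ ^ 2 := by
  have hentry (i : m) (j : ι) : ‖u j • x i + v j • y i‖ ^ 2 =
      ‖x i‖ ^ 2 * ‖u j‖ ^ 2 + 2 * (inner ℝ (x i) (y i) * inner ℝ (u j) (v j)) +
        ‖y i‖ ^ 2 * ‖v j‖ ^ 2 := by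
    rw [norm_add_sq_real, norm_smul, norm_smul, real_inner_smul_left, real_inner_smul_right,
      Real.inner_apply]
    ring
  simp only [hentry, PiLp.norm_sq_eq_of_L2, PiLp.inner_apply, Finset.sum_add_distrib,
    Finset.sum_mul_sum, ← Finset.mul_sum]

variable [MeasurableSpace H] [BorelSpace H] [FiniteDimensional ℝ H]

lemma charFun_map_smulVec_prod (hb : 0 < b) (u v : EuclideanSpace ℝ ι)
    (y : WithLp 2 ((PiLp 2 fun _ : m => H) × (PiLp 2 fun _ : m => H))) :
    charFun ((gaussMeasure m ι H b).map fun Z => WithLp.toLp 2 (smulVec u Z, smulVec v Z)) y =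
      Complex.exp (-(‖y.fst‖ ^ 2 * ‖u‖ ^ 2 + 2 * (inner ℝ y.fst y.snd * inner ℝ u v) +
        ‖y.snd‖ ^ 2 * ‖v‖ ^ 2 : ℝ) / (4 * b)) := by
  rw [charFun_apply, integral_map (by fun_prop) (by fun_prop), ← sum_norm_sq_smul_add_smul,
    ← integral_cexp_gaussMeasure hb]
  congr with Z
  congr 3
  simp [WithLp.prod_inner_apply, PiLp.inner_apply, smulVec_apply, inner_add_left, sum_inner,
    real_inner_smul_left, real_inner_smul_right, Finset.sum_add_distrib, real_inner_comm]

lemma map_smulVec_prod_eq (hb : 0 < b) {u v : EuclideanSpace ℝ ι} {u' v' : EuclideanSpace ℝ κ}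
    (hu : ‖u‖ = ‖u'‖) (hv : ‖v‖ = ‖v'‖) (huv : inner ℝ u v = inner ℝ u' v') :
    (gaussMeasure m ι H b).map (fun Z => WithLp.toLp 2 (smulVec u Z, smulVec v Z)) =
      (gaussMeasure m κ H b).map fun Z => WithLp.toLp 2 (smulVec u' Z, smulVec v' Z) := by
  have := isProbabilityMeasure_gaussMeasure (m := m) (ι := ι) (H := H) hb
  have := isProbabilityMeasure_gaussMeasure (m := m) (ι := κ) (H := H) hb
  refine Measure.ext_of_charFun (funext fun y => ?_)
  rw [charFun_map_smulVec_prod hb, charFun_map_smulVec_prod hb, hu, hv, huv]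

lemma ae_smulVec_ne_zero [Nonempty m] [Nontrivial H] {u : EuclideanSpace ℝ ι} (hu : u ≠ 0) :
    ∀ᵐ Z ∂gaussMeasure m ι H b, smulVec u Z ≠ 0 := by
  have : (volume : Measure (ι → H)).IsAddHaarMeasure := Measure.pi.isAddHaarMeasure _
  have : (volume : Measure (m → ι → H)).IsAddHaarMeasure := Measure.pi.isAddHaarMeasure _
  have hker : (smulVec u : (m → ι → H) →L[ℝ] _).ker ≠ ⊤ := fun htop =>
    smulVec_ne_zero hu (ContinuousLinearMap.coe_injective (LinearMap.ker_eq_top.1 htop))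
  exact ae_gaussMeasure_of_ae_volume
    (measure_eq_zero_iff_ae_notMem.1 (Measure.addHaar_submodule volume _ hker))

/-- The expected inner product of the signs of `Z u` and `Z v` for a Gaussian matrix `Z`. -/
noncomputable def signCorr (m H : Type*) [Fintype m] [NormedAddCommGroup H]
    [InnerProductSpace ℝ H] [FiniteDimensional ℝ H] [MeasurableSpace H] [BorelSpace H] (b : ℝ)
    (u v : EuclideanSpace ℝ ι) : ℝ :=
  ∫ Z, inner ℝ (normalize (smulVec u Z)) (normalize (smulVec v Z)) ∂gaussMeasure m ι H b

lemma measurable_normalize_smulVec (u : EuclideanSpace ℝ ι) :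
    Measurable fun Z : m → ι → H => normalize (smulVec u Z) := by
  unfold NormedSpace.normalize; fun_prop

lemma signCorr_eq_integral_map (u v : EuclideanSpace ℝ ι) :
    signCorr m H b u v =
      ∫ p : WithLp 2 ((PiLp 2 fun _ : m => H) × (PiLp 2 fun _ : m => H)),
        inner ℝ (normalize p.fst) (normalize p.snd)
        ∂(gaussMeasure m ι H b).map fun Z => WithLp.toLp 2 (smulVec u Z, smulVec v Z) := by
  rw [integral_map (by fun_prop) (by unfold NormedSpace.normalize; fun_prop)]
  rfl

lemma signCorr_congr (hb : 0 < b) {u v : EuclideanSpace ℝ ι} {u' v' : EuclideanSpace ℝ κ}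
    (hu : ‖u‖ = ‖u'‖) (hv : ‖v‖ = ‖v'‖) (huv : inner ℝ u v = inner ℝ u' v') :
    signCorr m H b u v = signCorr m H b u' v' := by
  rw [signCorr_eq_integral_map, signCorr_eq_integral_map, map_smulVec_prod_eq hb hu hv huv]

lemma norm_normalize_le_one {V : Type*} [NormedAddCommGroup V] [NormedSpace ℝ V] (x : V) :
    ‖normalize x‖ ≤ 1 := by
  by_cases hx : x = 0
  · simp [hx]
  · exact (NormedSpace.norm_normalize hx).le

lemma integrable_inner_of_norm_le_one {Ω 𝕜 E : Type*} [MeasurableSpace Ω] {μ : Measure Ω}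
    [IsFiniteMeasure μ] [RCLike 𝕜] [NormedAddCommGroup E] [InnerProductSpace 𝕜 E] {f g : Ω → E}
    (hf : AEStronglyMeasurable f μ) (hg : AEStronglyMeasurable g μ) (hf1 : ∀ ω, ‖f ω‖ ≤ 1)
    (hg1 : ∀ ω, ‖g ω‖ ≤ 1) : Integrable (fun ω => inner 𝕜 (f ω) (g ω)) μ :=
  .of_bound (hf.inner hg) 1 (.of_forall fun ω =>
    (norm_inner_le_norm _ _).trans (mul_le_one₀ (hf1 ω) (norm_nonneg _) (hg1 ω)))

lemma integrable_inner_normalize_smulVec (hb : 0 < b) (u v : EuclideanSpace ℝ ι) :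
    Integrable (fun Z => inner ℝ (normalize (smulVec u Z)) (normalize (smulVec v Z)))
      (gaussMeasure m ι H b) := by
  have := isProbabilityMeasure_gaussMeasure (m := m) (ι := ι) (H := H) hb
  exact integrable_inner_of_norm_le_one (measurable_normalize_smulVec u).aestronglyMeasurable
    (measurable_normalize_smulVec v).aestronglyMeasurable
    (fun _ => norm_normalize_le_one _) (fun _ => norm_normalize_le_one _)

lemma signCorr_self [Nonempty m] [Nontrivial H] (hb : 0 < b) {u : EuclideanSpace ℝ ι}
    (hu : u ≠ 0) : signCorr m H b u u = 1 := by
  have := isProbabilityMeasure_gaussMeasure (m := m) (ι := ι) (H := H) hb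
  calc signCorr m H b u u = ∫ _, 1 ∂gaussMeasure m ι H b := by
        refine integral_congr_ae ((ae_smulVec_ne_zero hu).mono fun Z hZ => ?_)
        dsimp only
        rw [real_inner_self_eq_norm_sq, NormedSpace.norm_normalize hZ, one_pow]
    _ = 1 := by simp

lemma signCorr_neg_right (u v : EuclideanSpace ℝ ι) :
    signCorr m H b u (-v) = -signCorr m H b u v := by
  simp only [signCorr, smulVec_neg, NormedSpace.normalize_neg, inner_neg_right, integral_neg]

lemma posSemidef_signCorr (hb : 0 < b) {s : Type*} [Finite s] (u : s → EuclideanSpace ℝ ι) :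
    (Matrix.of fun a a' => signCorr m H b (u a) (u a')).PosSemidef := by
  cases nonempty_fintype s
  refine Matrix.PosSemidef.of_dotProduct_mulVec_nonneg ?_ fun c => ?_
  · ext a a'
    simp [signCorr, real_inner_comm]
  calc 0 ≤ ∫ Z, ‖∑ a, c a • normalize (smulVec (u a) Z)‖ ^ 2 ∂gaussMeasure m ι H b :=
        integral_nonneg fun Z => sq_nonneg _
    _ = ∫ Z, ∑ a, ∑ a', c a' * (c a * inner ℝ (normalize (smulVec (u a) Z))
          (normalize (smulVec (u a') Z))) ∂gaussMeasure m ι H b := by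
        congr with Z
        rw [← real_inner_self_eq_norm_sq, sum_inner]
        simp only [inner_sum, real_inner_smul_left, real_inner_smul_right]
    _ = ∑ a, ∑ a', c a' * (c a * signCorr m H b (u a) (u a')) := by
        have hint (a a' : s) := ((integrable_inner_normalize_smulVec (m := m) (H := H) hb
          (u a) (u a')).const_mul (c a)).const_mul (c a')
        rw [integral_finsetSum _ fun a _ => integrable_finsetSum _ fun a' _ => hint a a']
        simp only [integral_finsetSum _ fun a' _ => hint _ a', integral_const_mul, signCorr]
    _ = star c ⬝ᵥ Matrix.mulVec (Matrix.of fun a a' => signCorr m H b (u a) (u a')) c := by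
        simp only [dotProduct, Matrix.mulVec, Matrix.of_apply, star_trivial, Finset.mul_sum]
        exact Finset.sum_congr rfl fun a _ => Finset.sum_congr rfl fun a' _ => by ring

/-- The function `φ` with `signCorr u v = φ ⟪u, v⟫` for all unit vectors `u` and `v`, read off from
two unit vectors in the plane. -/
noncomputable def signPhi (m H : Type*) [Fintype m] [NormedAddCommGroup H]
    [InnerProductSpace ℝ H] [FiniteDimensional ℝ H] [MeasurableSpace H] [BorelSpace H] (b : ℝ)
    (t : ℝ) : ℝ :=
  signCorr m H b !₂[1, 0] !₂[t, √(1 - t ^ 2)]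

lemma signCorr_eq_signPhi (hb : 0 < b) {u v : EuclideanSpace ℝ ι} (hu : ‖u‖ = 1) (hv : ‖v‖ = 1) :
    signCorr m H b u v = signPhi m H b (inner ℝ u v) := by
  have hle : (inner ℝ u v) ^ 2 ≤ 1 := by
    rw [sq_le_one_iff_abs_le_one]
    simpa [hu, hv] using abs_real_inner_le_norm u v
  refine signCorr_congr hb ?_ ?_ ?_
  · simp [hu, EuclideanSpace.norm_eq]
  · simp [hv, EuclideanSpace.norm_eq, Real.sq_sqrt (sub_nonneg.2 hle)]
  · simp [PiLp.inner_apply]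

lemma isSpherePosDef_signPhi (hb : 0 < b) : IsSpherePosDef (signPhi m H b) := by
  intro s ι _ _ u hu
  convert posSemidef_signCorr (m := m) (H := H) hb u using 1
  ext a a'
  simp [signCorr_eq_signPhi hb (hu a) (hu a')]

lemma exists_inner_eq_of_abs_le_one {t : ℝ} (ht : |t| ≤ 1) :
    ∃ u v : EuclideanSpace ℝ (Fin 2), ‖u‖ = 1 ∧ ‖v‖ = 1 ∧ inner ℝ u v = t := by
  have hle := sub_nonneg.2 ((sq_le_one_iff_abs_le_one t).2 ht)
  refine ⟨!₂[1, 0], !₂[t, √(1 - t ^ 2)], ?_, ?_, ?_⟩ <;>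
    simp [EuclideanSpace.norm_eq, PiLp.inner_apply, Real.sq_sqrt hle]

lemma signPhi_one [Nonempty m] [Nontrivial H] (hb : 0 < b) : signPhi m H b 1 = 1 := by
  obtain ⟨u, -, hu, -, -⟩ := exists_inner_eq_of_abs_le_one (t := 1) (by simp)
  have hself := signCorr_eq_signPhi (m := m) (H := H) hb hu hu
  rw [real_inner_self_eq_norm_sq, hu, one_pow] at hself
  rw [← hself, signCorr_self hb (norm_ne_zero_iff.1 (hu.trans_ne one_ne_zero))]

lemma signPhi_neg (hb : 0 < b) {t : ℝ} (ht : |t| ≤ 1) :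
    signPhi m H b (-t) = -signPhi m H b t := by
  obtain ⟨u, v, hu, hv, rfl⟩ := exists_inner_eq_of_abs_le_one ht
  rw [← inner_neg_right, ← signCorr_eq_signPhi hb hu (by rwa [norm_neg]),
    ← signCorr_eq_signPhi hb hu hv, signCorr_neg_right]

lemma signPhi_zero (hb : 0 < b) : signPhi m H b 0 = 0 :=
  self_eq_neg.1 (by simpa using signPhi_neg (m := m) (H := H) hb (t := 0) (by simp))

end SignCorrelation

section Rounding

open NormedSpace (normalize)

variable {m H : Type*} [Fintype m] [NormedAddCommGroup H] [InnerProductSpace ℝ H]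
  [FiniteDimensional ℝ H] [MeasurableSpace H] [BorelSpace H] {b : ℝ}

/-- The Goemans–Williamson ratio `inf (1 + φ(x)) / (1 + x)`, for the `φ` of `signPhi`. -/
noncomputable def signAlpha (m H : Type*) [Fintype m] [NormedAddCommGroup H]
    [InnerProductSpace ℝ H] [FiniteDimensional ℝ H] [MeasurableSpace H] [BorelSpace H]
    (b : ℝ) : ℝ :=
  ⨅ x : Set.Icc (0 : ℝ) 1, (1 + signPhi m H b x) / (1 + x)

variable [Nonempty m] [Nontrivial H]

lemma signPhi_nonneg (hb : 0 < b) {t : ℝ} (ht : t ∈ Set.Icc 0 1) : 0 ≤ signPhi m H b t :=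
  (isSpherePosDef_signPhi hb).apply_nonneg (signPhi_one hb) ht.1 ht.2

lemma signAlpha_mul_le (hb : 0 < b) {t : ℝ} (ht : t ∈ Set.Icc 0 1) :
    signAlpha m H b * (1 + t) ≤ 1 + signPhi m H b t := by
  refine (le_div_iff₀ (by linarith [ht.1])).1 (ciInf_le ⟨0, ?_⟩ (⟨t, ht⟩ : Set.Icc (0 : ℝ) 1))
  rintro _ ⟨x, rfl⟩
  exact div_nonneg (add_nonneg zero_le_one (signPhi_nonneg hb x.2)) (by linarith [x.2.1])

lemma signAlpha_pos (hb : 0 < b) : 0 < signAlpha m H b := by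
  have : Nonempty (Set.Icc (0 : ℝ) 1) := ⟨0, by simp⟩
  refine one_half_pos.trans_le (le_ciInf fun x => ?_)
  rw [div_le_div_iff₀ two_pos (by linarith [x.2.1])]
  linarith [signPhi_nonneg (m := m) (H := H) hb x.2, x.2.2]

lemma signAlpha_mul_one_sub_le (hb : 0 < b) {t : ℝ} (ht : |t| ≤ 1) :
    signAlpha m H b * (1 - t) ≤ 1 - signPhi m H b t := by
  obtain ⟨h1, h2⟩ := abs_le.1 ht
  rcases le_total 0 t with h0 | h0
  · have hle : signAlpha m H b ≤ 1 := by
      simpa [signPhi_zero hb] using signAlpha_mul_le (m := m) (H := H) hb (t := 0) (by simp)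
    have hphi : signPhi m H b t ≤ t :=
      (isSpherePosDef_signPhi hb).apply_le_self (signPhi_zero hb) (signPhi_one hb) h0 h2
    nlinarith
  · have h := signAlpha_mul_le (m := m) (H := H) hb (t := -t) ⟨by linarith, by linarith⟩
    rw [signPhi_neg hb ht] at h
    linarith

lemma sum_laplacian_mul {ι : Type*} [Fintype ι] [DecidableEq ι] (A : Matrix ι ι ℝ)
    {G : ι → ι → ℝ} (hG : ∀ i, G i i = 1) :
    ∑ i, ∑ j, (Matrix.diagonal (fun i => ∑ j, A i j) - A) i j * G i j =
      ∑ i, ∑ j, A i j * (1 - G i j) := by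
  refine Finset.sum_congr rfl fun i _ => ?_
  simp [Matrix.diagonal_apply, sub_mul, mul_sub, Finset.sum_sub_distrib, hG]

lemma sum_mul_signCorr_le_gammaOn (hb : 0 < b) {ι : Type*} [Fintype ι] {n : ℕ}
    (A : Matrix (Fin n) (Fin n) ℝ) {x : Fin n → EuclideanSpace ℝ ι} (hx : ∀ i, x i ≠ 0) :
    ∑ i, ∑ j, A i j * signCorr m H b (x i) (x j) ≤ gammaOn ℝ (PiLp 2 fun _ : m => H) A := by
  have := isProbabilityMeasure_gaussMeasure (m := m) (ι := ι) (H := H) hb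
  have hint (i j) := (integrable_inner_normalize_smulVec (m := m) (H := H) hb
    (x i) (x j)).const_mul (A i j)
  calc ∑ i, ∑ j, A i j * signCorr m H b (x i) (x j)
      = ∫ Z, ∑ i, ∑ j, A i j * inner ℝ (normalize (smulVec (x i) Z))
          (normalize (smulVec (x j) Z)) ∂gaussMeasure m ι H b := by
        rw [integral_finsetSum _ fun i _ => integrable_finsetSum _ fun j _ => hint i j]
        simp only [integral_finsetSum _ fun j _ => hint _ j, integral_const_mul, signCorr]
    _ ≤ ∫ _, gammaOn ℝ (PiLp 2 fun _ : m => H) A ∂gaussMeasure m ι H b := by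
        refine integral_mono_ae (integrable_finsetSum _ fun i _ => integrable_finsetSum _ fun j _ =>
          hint i j) (integrable_const _) ?_
        filter_upwards [ae_all_iff.2 fun i => ae_smulVec_ne_zero (m := m) (H := H) (b := b) (hx i)]
          with Z hZ
        exact (le_abs_self _).trans
          (norm_sum_mul_inner_le_gammaOn A fun i => NormedSpace.norm_normalize (hZ i))
    _ = gammaOn ℝ (PiLp 2 fun _ : m => H) A := by simp

theorem signAlpha_mul_gammaNorm_le (hb : 0 < b) {n : ℕ} {L : Matrix (Fin n) (Fin n) ℝ}
    (hL : L ∈ laplacianCone n) :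
    signAlpha m H b * gammaNorm ℝ L ≤ gammaOn ℝ (PiLp 2 fun _ : m => H) L := by
  have hα := signAlpha_pos (m := m) (H := H) hb
  rw [← le_div_iff₀' hα]
  refine gammaOn_le (div_nonneg (gammaOn_nonneg _) hα.le) fun x hx => ?_
  rw [le_div_iff₀' hα]
  have hx0 (i) : x i ≠ 0 := norm_ne_zero_iff.1 ((hx i).trans_ne one_ne_zero)
  have habs (i j) : |inner ℝ (x i) (x j)| ≤ 1 := by
    simpa [hx] using abs_real_inner_le_norm (x i) (x j)
  obtain ⟨A, -, -, hA, rfl⟩ := hL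
  set L := Matrix.diagonal (fun i => ∑ j, A i j) - A
  have hform : ∑ i, ∑ j, L i j * inner ℝ (x i) (x j) =
      ∑ i, ∑ j, A i j * (1 - inner ℝ (x i) (x j)) := sum_laplacian_mul A fun i => by simp [hx]
  have hnonneg : 0 ≤ ∑ i, ∑ j, A i j * (1 - inner ℝ (x i) (x j)) :=
    Finset.sum_nonneg fun i _ => Finset.sum_nonneg fun j _ =>
      mul_nonneg (hA i j) (sub_nonneg.2 (abs_le.1 (habs i j)).2)
  calc signAlpha m H b * ‖∑ i, ∑ j, L i j * inner ℝ (x i) (x j)‖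
      = ∑ i, ∑ j, A i j * (signAlpha m H b * (1 - inner ℝ (x i) (x j))) := by
        rw [hform, Real.norm_of_nonneg hnonneg]
        simp only [Finset.mul_sum, mul_left_comm]
    _ ≤ ∑ i, ∑ j, A i j * (1 - signCorr m H b (x i) (x j)) := by
        gcongr with i _ j _
        · exact hA i j
        · rw [signCorr_eq_signPhi hb (hx i) (hx j)]
          exact signAlpha_mul_one_sub_le hb (habs i j)
    _ = ∑ i, ∑ j, L i j * signCorr m H b (x i) (x j) :=
        (sum_laplacian_mul A fun i => signCorr_self hb (hx0 i)).symm
    _ ≤ gammaOn ℝ (PiLp 2 fun _ : m => H) L := sum_mul_signCorr_le_gammaOn hb L hx0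

end Rounding

section Identification

open NormedSpace (normalize)

variable {d n : ℕ}

lemma vecSign_eq_normalize {𝕜 : Type} [RCLike 𝕜] {z : EuclideanSpace 𝕜 (Fin d)} (hz : z ≠ 0) :
    vecSign z = normalize z := by
  ext i
  simp [vecSign, hz, NormedSpace.normalize, RCLike.real_smul_eq_coe_mul]

lemma prod_gaussPDF_real (Z : Fin d → Fin n → ℝ) :
    ∏ i, ∏ j, gaussPDF (1 / 2) (Z i j) = gaussReal d n Z := by
  simp only [gaussPDF, gaussReal, Finset.prod_mul_distrib, ← Real.exp_sum, Finset.prod_const,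
    Finset.card_univ, Fintype.card_fin, ← Finset.mul_sum, Module.finrank_self, Nat.cast_one]
  congr 1
  · rw [← Real.rpow_mul_natCast (by positivity), ← Real.rpow_mul_natCast (by positivity)]
    congr 1 <;> ring
  · ring_nf

lemma prod_gaussPDF_complex (Z : Fin d → Fin n → ℂ) :
    ∏ i, ∏ j, gaussPDF 1 (Z i j) = gaussComplex d n Z := by
  simp only [gaussPDF, gaussComplex, Finset.prod_mul_distrib, ← Real.exp_sum, Finset.prod_const,
    Finset.card_univ, Fintype.card_fin, Finset.sum_neg_distrib, Complex.finrank_real_complex,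
    neg_one_mul, div_one, Nat.cast_two, div_self (two_ne_zero' ℝ)]
  rw [← Real.rpow_mul_natCast (by positivity), ← Real.rpow_mul_natCast (by positivity)]
  ring_nf

lemma matVec_real_eq_smulVec (Z : Fin d → Fin n → ℝ) (u : EuclideanSpace ℝ (Fin n)) :
    matVec Z u = smulVec u Z := by
  ext i
  simp [matVec, smulVec_apply, mul_comm]

lemma matVec_complex_eq_smulVec (Z : Fin d → Fin n → ℂ) (u : EuclideanSpace ℝ (Fin n)) :
    matVec Z (WithLp.toLp 2 fun j => (u j : ℂ)) = smulVec u Z := by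
  ext i
  simp [matVec, smulVec_apply, mul_comm]

lemma signIntegralReal_eq_signCorr [NeZero d] {u v : EuclideanSpace ℝ (Fin n)} (hu : u ≠ 0)
    (hv : v ≠ 0) : signIntegralReal d u v = signCorr (Fin d) ℝ (1 / 2) u v := by
  calc signIntegralReal d u v
      = ∫ Z, inner ℝ (vecSign (matVec Z u)) (vecSign (matVec Z v))
          ∂gaussMeasure (Fin d) (Fin n) ℝ (1 / 2) := by
        rw [integral_gaussMeasure one_half_pos]
        simp only [prod_gaussPDF_real, signIntegralReal, smul_eq_mul, mul_comm]
    _ = signCorr (Fin d) ℝ (1 / 2) u v := by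
        refine integral_congr_ae ?_
        filter_upwards [ae_smulVec_ne_zero hu, ae_smulVec_ne_zero hv] with Z hZu hZv
        simp only [matVec_real_eq_smulVec, vecSign_eq_normalize hZu, vecSign_eq_normalize hZv]

lemma re_signIntegralComplex_eq_signCorr [NeZero d] {u v : EuclideanSpace ℝ (Fin n)} (hu : u ≠ 0)
    (hv : v ≠ 0) :
    (signIntegralComplex d (WithLp.toLp 2 fun j => (u j : ℂ))
      (WithLp.toLp 2 fun j => (v j : ℂ))).re = signCorr (Fin d) ℂ 1 u v := by
  have := isProbabilityMeasure_gaussMeasure (m := Fin d) (ι := Fin n) (H := ℂ) one_pos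
  have hint : Integrable (fun Z => inner ℂ (normalize (smulVec u Z)) (normalize (smulVec v Z)))
      (gaussMeasure (Fin d) (Fin n) ℂ 1) :=
    integrable_inner_of_norm_le_one (measurable_normalize_smulVec u).aestronglyMeasurable
      (measurable_normalize_smulVec v).aestronglyMeasurable
      (fun _ => norm_normalize_le_one _) (fun _ => norm_normalize_le_one _)
  calc (signIntegralComplex d (WithLp.toLp 2 fun j => (u j : ℂ))
        (WithLp.toLp 2 fun j => (v j : ℂ))).re
      = (∫ Z, inner ℂ (vecSign (smulVec u Z)) (vecSign (smulVec v Z))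
          ∂gaussMeasure (Fin d) (Fin n) ℂ 1).re := by
        rw [integral_gaussMeasure one_pos]
        simp only [prod_gaussPDF_complex, signIntegralComplex, Complex.real_smul, mul_comm,
          matVec_complex_eq_smulVec]
    _ = (∫ Z, inner ℂ (normalize (smulVec u Z)) (normalize (smulVec v Z))
          ∂gaussMeasure (Fin d) (Fin n) ℂ 1).re := by
        congr 1
        refine integral_congr_ae ?_
        filter_upwards [ae_smulVec_ne_zero hu, ae_smulVec_ne_zero hv] with Z hZu hZv
        rw [vecSign_eq_normalize hZu, vecSign_eq_normalize hZv]
    _ = signCorr (Fin d) ℂ 1 u v := by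
        simp only [signCorr, real_inner_eq_re_inner_euclideanSpace]
        exact (integral_re hint).symm

lemma vec_zero_right_ne_zero : !₂[(1 : ℝ), 0] ≠ 0 := fun h => by
  simpa using congr($h 0)

lemma vec_sqrt_one_sub_sq_ne_zero (x : ℝ) : !₂[x, √(1 - x ^ 2)] ≠ 0 := fun h => by
  have h0 : x = 0 := congr($h 0)
  simpa [h0] using congr($h 1)

lemma signPhi_real_eq_phiReal [NeZero d] (x : ℝ) :
    signPhi (Fin d) ℝ (1 / 2) x = phiReal d x :=
  (signIntegralReal_eq_signCorr vec_zero_right_ne_zero (vec_sqrt_one_sub_sq_ne_zero x)).symm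

lemma signPhi_complex_eq_re_phiComplex [NeZero d] (x : ℝ) :
    signPhi (Fin d) ℂ 1 x = (phiComplex d x).re := by
  rw [signPhi, ← re_signIntegralComplex_eq_signCorr vec_zero_right_ne_zero
    (vec_sqrt_one_sub_sq_ne_zero x), phiComplex]
  congr <;> ext j <;> fin_cases j <;> simp

lemma signAlpha_real_eq_alphaReal [NeZero d] : signAlpha (Fin d) ℝ (1 / 2) = alphaReal d := by
  simp only [signAlpha, alphaReal, signPhi_real_eq_phiReal]

lemma signAlpha_complex_eq_alphaComplex [NeZero d] : signAlpha (Fin d) ℂ 1 = alphaComplex d := by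
  simp only [signAlpha, alphaComplex, signPhi_complex_eq_re_phiComplex]

end Identification

section AlphaBound

variable {d : ℕ} [NeZero d]

lemma inv_alphaReal_mem_gwBounds : (alphaReal d)⁻¹ ∈ gwBounds ℝ d := by
  rw [← signAlpha_real_eq_alphaReal]
  have hα := signAlpha_pos (m := Fin d) (H := ℝ) one_half_pos
  refine ⟨inv_pos.2 hα, fun n L hL => (le_inv_mul_iff₀ hα).2 ?_⟩
  rw [toField_real]
  exact signAlpha_mul_gammaNorm_le one_half_pos hL

lemma inv_alphaComplex_mem_gwBounds : (alphaComplex d)⁻¹ ∈ gwBounds ℂ d := by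
  rw [← signAlpha_complex_eq_alphaComplex]
  have hα := signAlpha_pos (m := Fin d) (H := ℂ) one_pos
  refine ⟨inv_pos.2 hα, fun n L hL => (le_inv_mul_iff₀ hα).2 ?_⟩
  rw [gammaNorm_complex_eq (isSymm_of_mem_laplacianCone hL),
    gammaRank_complex_eq_gammaOn (isSymm_of_mem_laplacianCone hL)]
  exact signAlpha_mul_gammaNorm_le one_pos hL

end AlphaBound

lemma gwConst_spec {𝕜 : Type} [RCLike 𝕜] {d : ℕ} {α : ℝ} (hα : α⁻¹ ∈ gwBounds 𝕜 d) :
    IsLeast (gwBounds 𝕜 d) (gwConst 𝕜 d) ∧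
      conicConstTop 𝕜 (laplacianFamily 𝕜) d = ENNReal.ofReal (gwConst 𝕜 d) ∧
      Tendsto (fun p : ℕ => conicConst 𝕜 (laplacianFamily 𝕜) d p) atTop
        (𝓝 (ENNReal.ofReal (gwConst 𝕜 d))) ∧
      gwConst 𝕜 d ≤ 1 / α := by
  have hleast := isLeast_gwConst ⟨_, hα⟩
  have htop := conicConstTop_eq_ofReal_gwConst ⟨_, hα⟩
  exact ⟨hleast, htop, htop ▸ tendsto_conicConst 𝕜 _ d, by simpa using hleast.2 hα⟩

end GW

theorem proposition5p7 (d : ℕ) (hd : 1 ≤ d) :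
    -- over the reals
    (IsLeast (GW.gwBounds ℝ d) (GW.gwConst ℝ d) ∧
      GW.conicConstTop ℝ (GW.laplacianFamily ℝ) d = ENNReal.ofReal (GW.gwConst ℝ d) ∧
      Tendsto (fun p : ℕ => GW.conicConst ℝ (GW.laplacianFamily ℝ) d p) atTop
        (𝓝 (ENNReal.ofReal (GW.gwConst ℝ d))) ∧
      GW.gwConst ℝ d ≤ 1 / GW.alphaReal d) ∧
    -- over the complex numbers
    (IsLeast (GW.gwBounds ℂ d) (GW.gwConst ℂ d) ∧
      GW.conicConstTop ℂ (GW.laplacianFamily ℂ) d = ENNReal.ofReal (GW.gwConst ℂ d) ∧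
      Tendsto (fun p : ℕ => GW.conicConst ℂ (GW.laplacianFamily ℂ) d p) atTop
        (𝓝 (ENNReal.ofReal (GW.gwConst ℂ d))) ∧
      GW.gwConst ℂ d ≤ 1 / GW.alphaComplex d) ∧
    -- relation between the two fields
    GW.gwConst ℂ d = GW.gwConst ℝ (2 * d) := by
  have : NeZero d := ⟨Nat.one_le_iff_ne_zero.1 hd⟩
  exact ⟨GW.gwConst_spec GW.inv_alphaReal_mem_gwBounds,
    GW.gwConst_spec GW.inv_alphaComplex_mem_gwBounds,
    by rw [GW.gwConst, GW.gwConst, GW.gwBounds_complex_eq]⟩
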